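/- For a finite Borel measure $\mu$ on $\mathbb{C}$ with compact and infinite support, let $\Phi_n(\cdot;\mu)$ ($n\ge 0$) be its monic orthogonal polynomials, i.e. $\Phi_n(\cdot;\mu)$ is the monic polynomial of degree $n$ that is orthogonal in $L^2(\mu)$ to all polynomials of degree less than $n$, and let $\|\mathcal{M}_\mu\|$ be the operator norm of $\mathcal{M}_\mu:L^2(\mu)\to L^2(\mu)$, $(\mathcal{M}_\mu g)(z)=z\,g(z)$. (1) Let $\mu$ be a finite Borel measure whose support is an infinite compact subset of $\mathbb{R}$, let $\mathcal{N}\subseteq\{1,2,3,\dots\}$ be infinite, and let $f$ be a function such that $$\lim_{n\to\infty,\ n\in\mathcal{N}}\frac{\Phi_{n-1}(z;\mu)}{\Phi_n(z;\mu)}=f(z)\qquad\text{for all } z\in\mathbb{C} \text{ with } |z|>\|\mathcal{M}_\mu\|.$$ Then there is a compactly supported probability measure $\nu$ on $\mathbb{R}$ such that $$f(z)=\int_{\mathbb{R}}\frac{1}{z-w}\,d\nu(w)\qquad\text{for all } z\in\mathbb{C} \text{ with } |z|>\|\mathcal{M}_\mu\|,$$ the integrals being absolutely convergent. (2) Conversely,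 for every compactly supported probability measure $\nu$ on $\mathbb{R}$ there are a probability measure $\mu$ whose support is an infinite compact subset of $\mathbb{R}$ and an infinite set $\mathcal{N}\subseteq\{1,2,3,\dots\}$ such that $$\lim_{n\to\infty,\ n\in\mathcal{N}}\frac{\Phi_{n-1}(z;\mu)}{\Phi_n(z;\mu)}=\int_{\mathbb{R}}\frac{1}{z-w}\,d\nu(w)\qquad\text{for all } z\in\mathbb{C} \text{ with } |z|>\|\mathcal{M}_\mu\|,$$ the integrals being absolutely convergent. -/

import Mathlib

open MeasureTheory Filter Topology Polynomial
open scoped ENNReal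

noncomputable section

namespace RatioAsymptotics

/-- The `L²(μ)` pairing `∫ conj (P z) * Q z dμ(z)` of two polynomials
(conjugate-linear in the first argument). -/
def polyInner (μ : Measure ℂ) (P Q : ℂ[X]) : ℂ :=
  ∫ z, (starRingEnd ℂ) (P.eval z) * Q.eval z ∂μ

/-- The monic orthogonal polynomials `Φ_n(·; μ)`, obtained by the (unnormalized) Gram-Schmidt
process applied to `1, z, z², …` in `L²(μ)`:
`Φ_n = zⁿ - ∑_{k < n} (⟨Φ_k, zⁿ⟩ / ⟨Φ_k, Φ_k⟩) Φ_k`. -/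
def monicOP (μ : Measure ℂ) (n : ℕ) : ℂ[X] :=
  X ^ n - ∑ k : Fin n,
    C (polyInner μ (monicOP μ k) (X ^ n) / polyInner μ (monicOP μ k) (monicOP μ k)) *
      monicOP μ k
termination_by n
decreasing_by exact k.isLt

/-- The coordinate function is essentially bounded for a measure with compact support. -/
theorem memLp_top_id {μ : Measure ℂ} (hμ : IsCompact μ.support) :
    MemLp (fun z : ℂ => z) ∞ μ := by
  obtain ⟨R, hR⟩ := hμ.isBounded.exists_norm_le
  refine memLp_top_of_bound aestronglyMeasurable_id R ?_
  filter_upwards [Measure.support_mem_ae (μ := μ)] with z hz using hR z hz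

/-- The operator `ℳ : L²(μ) → L²(μ)`, `(ℳ f)(z) = z f(z)`, for a measure `μ` on `ℂ` with
compact support, as a bounded operator. Its norm `‖ℳ‖` is the operator norm. -/
def mulZ (μ : Measure ℂ) (hμ : IsCompact μ.support) : Lp ℂ 2 μ →L[ℂ] Lp ℂ 2 μ :=
  (ContinuousLinearMap.mul ℂ ℂ).holderL μ ∞ 2 2 ((memLp_top_id hμ).toLp (fun z : ℂ => z))

/-- `𝒩 ⊆ {1, 2, 3, …}` is an infinite set of indices along which
`Φ_{n-1}(z; μ) / Φ_n(z; μ) → f z` for every `z` with `|z| > ‖ℳ‖`. -/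
structure IsRatioLimitAlong (μ : Measure ℂ) (hμ : IsCompact μ.support) (N : Set ℕ)
    (f : ℂ → ℂ) : Prop where
  one_le : ∀ n ∈ N, 1 ≤ n
  infinite : N.Infinite
  tendsto : ∀ z : ℂ, ‖mulZ μ hμ‖ < ‖z‖ →
    Tendsto (fun n : ℕ => (monicOP μ (n - 1)).eval z / (monicOP μ n).eval z)
      (atTop ⊓ 𝓟 N) (𝓝 (f z))

/-- `f` is the Stieltjes transform `f z = ∫ 1 / (z - w) dν(w)` of `ν` on `{z : |z| > r}`
(the integrals being required to converge absolutely). -/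
def IsStieltjesOutside (ν : Measure ℝ) (r : ℝ) (f : ℂ → ℂ) : Prop :=
  ∀ z : ℂ, r < ‖z‖ →
    Integrable (fun w : ℝ => 1 / (z - (w : ℂ))) ν ∧ f z = ∫ w : ℝ, 1 / (z - (w : ℂ)) ∂ν

end RatioAsymptotics

end

open MeasureTheory Filter Topology Polynomial
open scoped ENNReal

noncomputable section

namespace RatioAsymptotics

/-! ### Polynomials in `L²(μ)` and orthogonality. -/

section Polynomials

variable {μ : Measure ℂ}

/-! Let `T` be the compression of multiplication by `z` to polynomials of degree at most `n`; it is
symmetric because `μ` lives on the real line. The ratio `Φ_n(z) / Φ_{n+1}(z)` is the resolvent entry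
`⟨e, (z - T)⁻¹ e⟩` at `e = Φ_n / ‖Φ_n‖`, hence the Stieltjes transform of a spectral measure on
`[-‖ℳ‖, ‖ℳ‖]` (`exists_ratioMeasure`). Weak compactness of the probability measures on this interval
gives the direct half.

Conversely, Schur complements expand the Stieltjes transform of `ν` into a continued fraction `g_k
(z - β_k - α_k² g_{k+1}) = 1` (`IsResolventFunction.exists_step`), while the ratios `r_n =
Φ_{n-1}/Φ_n` obey `r_{n+1} (z - b_n - a_n² r_n) = 1`. The index runs in opposite directions, so the
recurrence coefficients of `μ` are ever longer initial segments of `(β, α)` written backwards. For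
large `|z|` each step is nearly a contraction, so at the end of a long block the ratio has forgotten
its start and is close to `g_0` (`norm_sub_le_of_block`). A perturbation `1/(m+1)` in block `m`
keeps the off-diagonal coefficients nonzero, so Favard's theorem (`exists_measure_of_recurrence`)
yields a measure of infinite support even if the continued fraction terminates. A large `b_0` forces
`‖ℳ‖` past the contraction threshold (`abs_le_norm_mulZ`). -/

theorem coeFn_mulZ (hμ : IsCompact μ.support) (g : Lp ℂ 2 μ) :
    mulZ μ hμ g =ᵐ[μ] fun z => z * g z := by
  have h := ContinuousLinearMap.coeFn_holder (r := 2) (ContinuousLinearMap.mul ℂ ℂ)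
    ((memLp_top_id hμ).toLp (fun z : ℂ => z)) g
  have h2 := MemLp.coeFn_toLp (memLp_top_id hμ)
  rw [mulZ, ContinuousLinearMap.holderL_apply_apply]
  filter_upwards [h, h2] with z h h2
  rw [h, h2]; rfl

theorem inner_mulZ_left (hμ : IsCompact μ.support)
    (hr : μ.support ⊆ Set.range (fun x : ℝ => (x : ℂ))) (f g : Lp ℂ 2 μ) :
    inner ℂ (mulZ μ hμ f) g = inner ℂ f (mulZ μ hμ g) := by
  rw [L2.inner_def, L2.inner_def]
  refine integral_congr_ae ?_
  filter_upwards [coeFn_mulZ hμ f, coeFn_mulZ hμ g, Measure.support_mem_ae (μ := μ)] with z h1 h2 h3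
  obtain ⟨x, rfl⟩ := hr h3
  simp only [h1, h2, RCLike.inner_apply, map_mul, Complex.conj_ofReal]
  ring

variable [IsFiniteMeasure μ]

theorem memLp_eval (hμ : IsCompact μ.support) (P : ℂ[X]) (p : ℝ≥0∞) :
    MemLp (fun z => P.eval z) p μ := by
  obtain ⟨C, hC⟩ := hμ.exists_bound_of_continuousOn (f := fun z => P.eval z)
    P.continuous.continuousOn
  have h : MemLp (fun z => P.eval z) ∞ μ := by
    refine memLp_top_of_bound P.continuous.aestronglyMeasurable C ?_
    filter_upwards [Measure.support_mem_ae (μ := μ)] with z hz using hC z hz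
  exact h.mono_exponent le_top

/-- The class of a polynomial in `L²(μ)`. -/
def polyLp (hμ : IsCompact μ.support) : ℂ[X] →ₗ[ℂ] Lp ℂ 2 μ where
  toFun P := (memLp_eval hμ P 2).toLp _
  map_add' P Q := by
    rw [← MemLp.toLp_add]
    exact MemLp.toLp_congr _ _ (by simp [Pi.add_def])
  map_smul' c P := by
    rw [RingHom.id_apply, ← MemLp.toLp_const_smul]
    exact MemLp.toLp_congr _ _ (by simp [Pi.smul_def])

theorem coeFn_polyLp (hμ : IsCompact μ.support) (P : ℂ[X]) :
    polyLp hμ P =ᵐ[μ] fun z => P.eval z :=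
  MemLp.coeFn_toLp (memLp_eval hμ P 2)

theorem inner_polyLp (hμ : IsCompact μ.support) (P Q : ℂ[X]) :
    inner ℂ (polyLp hμ P) (polyLp hμ Q) = polyInner μ P Q := by
  rw [L2.inner_def, polyInner]
  refine integral_congr_ae ?_
  filter_upwards [coeFn_polyLp hμ P, coeFn_polyLp hμ Q] with z h1 h2
  rw [h1, h2, RCLike.inner_apply, mul_comm]

theorem mulZ_polyLp (hμ : IsCompact μ.support) (P : ℂ[X]) :
    mulZ μ hμ (polyLp hμ P) = polyLp hμ (X * P) := by
  refine Lp.ext ?_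
  filter_upwards [coeFn_mulZ hμ (polyLp hμ P), coeFn_polyLp hμ P, coeFn_polyLp hμ (X * P)]
    with z h1 h2 h3
  rw [h1, h2, h3]; simp

/-- The zero set of `P` is closed and conull, so it contains the support, which is infinite. -/
theorem eq_zero_of_polyLp_eq_zero (hμ : IsCompact μ.support) (hinf : μ.support.Infinite)
    {P : ℂ[X]} (hP : polyLp hμ P = 0) : P = 0 := by
  have h1 : {z : ℂ | P.eval z = 0} ∈ ae μ := by
    have h := (coeFn_polyLp hμ P).symm
    rw [hP] at h
    filter_upwards [h, Lp.coeFn_zero ℂ 2 μ] with z h1 h2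
    exact h1.trans h2
  have h2 := Measure.support_subset_of_isClosed
    (isClosed_eq P.continuous continuous_const) h1
  exact Polynomial.eq_zero_of_infinite_isRoot P (hinf.mono h2)

theorem monicOP_sub_degree_lt (μ : Measure ℂ) (n : ℕ) :
    (X ^ n - monicOP μ n).degree < (n : WithBot ℕ) ∧ (monicOP μ n).Monic ∧ (monicOP μ n).natDegree = n := by
  induction n using Nat.strong_induction_on with
  | _ n ih =>
    have h : (X ^ n - monicOP μ n).degree < (n : WithBot ℕ) := by
      rw [monicOP, sub_sub_cancel]
      refine lt_of_le_of_lt (degree_sum_le _ _) ?_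
      rw [Finset.sup_lt_iff (by exact WithBot.bot_lt_coe n)]
      intro k _
      rw [← smul_eq_C_mul]
      refine lt_of_le_of_lt (degree_smul_le _ _) ?_
      rw [degree_eq_natDegree (ih k k.2).2.1.ne_zero, (ih k k.2).2.2]
      exact_mod_cast k.2
    have he : monicOP μ n = X ^ n - (X ^ n - monicOP μ n) := by ring
    refine ⟨h, ?_, ?_⟩
    · rw [he]; exact (monic_X_pow n).sub_of_left (by rwa [degree_X_pow])
    · rw [he, natDegree_eq_of_degree_eq_some]
      rw [degree_sub_eq_left_of_degree_lt (by rwa [degree_X_pow]), degree_X_pow]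

theorem monic_monicOP (μ : Measure ℂ) (n : ℕ) : (monicOP μ n).Monic :=
  (monicOP_sub_degree_lt μ n).2.1

theorem natDegree_monicOP (μ : Measure ℂ) (n : ℕ) : (monicOP μ n).natDegree = n :=
  (monicOP_sub_degree_lt μ n).2.2

/-- A linear functional vanishing on the first `n` members of a graded monic family vanishes on
all polynomials of degree less than `n`. -/
theorem linearMap_eq_zero_of_degree_lt {E : Type*} [AddCommGroup E] [Module ℂ E]
    {P : ℕ → ℂ[X]} (hP : ∀ n, (P n).Monic) (hd : ∀ n, (P n).natDegree = n)
    (ℓ : ℂ[X] →ₗ[ℂ] E) {n : ℕ} (h : ∀ k < n, ℓ (P k) = 0) {Q : ℂ[X]} (hQ : Q.degree < n) :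
    ℓ Q = 0 := by
  induction n generalizing Q with
  | zero =>
    have h0 : Q = 0 := by
      ext m
      exact (degree_lt_iff_coeff_zero _ _).1 hQ m (Nat.zero_le m)
    rw [h0, map_zero]
  | succ n ih =>
    have h1 : (Q - Q.coeff n • P n).degree < n := by
      rw [degree_lt_iff_coeff_zero]
      intro m hm
      rcases hm.eq_or_lt with rfl | hm
      · have := (hP n).coeff_natDegree
        rw [hd] at this
        simp [this]
      · have h2 : Q.coeff m = 0 := (degree_lt_iff_coeff_zero _ _).1 hQ m hm
        have h3 : (P n).coeff m = 0 := coeff_eq_zero_of_natDegree_lt (by rw [hd]; exact hm)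
        simp [h2, h3]
    have h2 := ih (fun k hk => h k (by omega)) h1
    rw [map_sub, map_smul, h n (by omega), smul_zero, sub_zero] at h2
    exact h2

theorem polyInner_self_ne_zero (hμ : IsCompact μ.support) (hinf : μ.support.Infinite)
    {P : ℂ[X]} (hP : P ≠ 0) : polyInner μ P P ≠ 0 := by
  rw [← inner_polyLp hμ]
  intro h
  exact hP (eq_zero_of_polyLp_eq_zero hμ hinf (inner_self_eq_zero.1 h))

theorem polyInner_monicOP_of_lt (hμ : IsCompact μ.support) (hinf : μ.support.Infinite)
    {k n : ℕ} (hk : k < n) : polyInner μ (monicOP μ k) (monicOP μ n) = 0 := by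
  induction n using Nat.strong_induction_on generalizing k with
  | _ n ih =>
    have h0 := polyInner_self_ne_zero hμ hinf (monic_monicOP μ k).ne_zero
    conv_lhs => rw [monicOP.eq_def μ n]
    rw [← inner_polyLp hμ, map_sub, map_sum, inner_sub_right, inner_sum,
      Finset.sum_eq_single (⟨k, hk⟩ : Fin n)]
    · rw [← smul_eq_C_mul, map_smul, inner_smul_right, inner_polyLp, inner_polyLp,
        div_mul_cancel₀ _ h0, sub_self]
    · intro j _ hj
      rw [← smul_eq_C_mul, map_smul, inner_smul_right, inner_polyLp]
      have : polyInner μ (monicOP μ k) (monicOP μ j) = 0 := by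
        rcases lt_trichotomy k j with h | h | h
        · exact ih j j.2 h
        · exact absurd (Fin.ext h.symm) hj
        · rw [← inner_polyLp hμ, ← inner_conj_symm, inner_polyLp, ih k hk h, map_zero]
      rw [this, mul_zero]
    · simp

theorem polyInner_eq_zero_of_forall_lt (hμ : IsCompact μ.support) {P : ℕ → ℂ[X]}
    (hP : ∀ n, (P n).Monic) (hd : ∀ n, (P n).natDegree = n) {R : ℂ[X]} {n : ℕ}
    (h : ∀ k < n, polyInner μ (P k) R = 0) {Q : ℂ[X]} (hQ : Q.degree < n) :
    polyInner μ Q R = 0 := by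
  have := linearMap_eq_zero_of_degree_lt hP hd
    ((innerSL ℂ (polyLp hμ R)).toLinearMap ∘ₗ polyLp hμ) (n := n) (Q := Q) (fun k hk => ?_) hQ
  · simp only [LinearMap.comp_apply, ContinuousLinearMap.coe_coe, innerSL_apply_apply] at this
    rw [← inner_polyLp hμ, ← inner_conj_symm, this, map_zero]
  · simp only [LinearMap.comp_apply, ContinuousLinearMap.coe_coe, innerSL_apply_apply]
    rw [← inner_conj_symm, inner_polyLp, h k hk, map_zero]

theorem polyInner_monicOP_of_degree_lt (hμ : IsCompact μ.support) (hinf : μ.support.Infinite)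
    {n : ℕ} {Q : ℂ[X]} (hQ : Q.degree < n) : polyInner μ Q (monicOP μ n) = 0 :=
  polyInner_eq_zero_of_forall_lt hμ (monic_monicOP μ) (natDegree_monicOP μ)
    (fun _ hk => polyInner_monicOP_of_lt hμ hinf hk) hQ

theorem eq_monicOP (hμ : IsCompact μ.support) (hinf : μ.support.Infinite) {n : ℕ} {Q : ℂ[X]}
    (hQ : Q.Monic) (hd : Q.natDegree = n) (h : ∀ R : ℂ[X], R.degree < n → polyInner μ R Q = 0) :
    monicOP μ n = Q := by
  have hdeg : (monicOP μ n - Q).degree < n := by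
    have h1 : (monicOP μ n).degree = n := by
      rw [degree_eq_natDegree (monic_monicOP μ n).ne_zero, natDegree_monicOP]
    rw [← h1]
    refine degree_sub_lt_left ?_ (monic_monicOP μ n).ne_zero ?_
    · rw [h1, degree_eq_natDegree hQ.ne_zero, hd]
    · rw [(monic_monicOP μ n).leadingCoeff, hQ.leadingCoeff]
  by_contra hne
  refine polyInner_self_ne_zero hμ hinf (sub_ne_zero.2 hne) ?_
  rw [← inner_polyLp hμ]
  nth_rewrite 2 [map_sub]
  rw [inner_sub_right, inner_polyLp, inner_polyLp, h _ hdeg,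
    polyInner_monicOP_of_degree_lt hμ hinf hdeg, sub_zero]

end Polynomials

/-! ### Spectral measures in finite dimension. -/

section SpectralMeasure

variable {E : Type*} [NormedAddCommGroup E] [InnerProductSpace ℂ E] [FiniteDimensional ℂ E]

/-- The spectral measure of a symmetric operator on a finite-dimensional space at a unit vector. -/
theorem exists_spectralMeasure {T : E →ₗ[ℂ] E} (hT : T.IsSymmetric) {R : ℝ}
    (hR : ∀ (x : ℝ) (v : E), v ≠ 0 → T v = (x : ℂ) • v → |x| ≤ R) {e : E} (he : ‖e‖ = 1) :
    ∃ ν : ProbabilityMeasure (Set.Icc (-R) R),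
      (∀ p q : ℂ[X], ∫ w, (starRingEnd ℂ) (p.eval ((w : ℝ) : ℂ)) * q.eval ((w : ℝ) : ℂ)
        ∂(ν : Measure (Set.Icc (-R) R)) = inner ℂ (aeval T p e) (aeval T q e)) ∧
      ∀ z : ℂ, R < ‖z‖ → ∀ y : E, z • y - T y = e →
        ∫ w, 1 / (z - ((w : ℝ) : ℂ)) ∂(ν : Measure (Set.Icc (-R) R)) = inner ℂ e y := by
  set b := hT.eigenvectorBasis rfl with hb
  set l := hT.eigenvalues rfl with hl
  have hTb : ∀ i, T (b i) = (l i : ℂ) • b i := fun i => hT.apply_eigenvectorBasis rfl i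
  have hlR : ∀ i, l i ∈ Set.Icc (-R) R := fun i =>
    abs_le.1 (hR (l i) (b i) (b.orthonormal.ne_zero i) (hTb i))
  have hsum : ∑ i, ‖inner ℂ (b i) e‖ ^ 2 = 1 := by
    rw [b.sum_sq_norm_inner_right, he, one_pow]
  set ν : Measure (Set.Icc (-R) R) :=
    ∑ i, ENNReal.ofReal (‖inner ℂ (b i) e‖ ^ 2) • Measure.dirac ⟨l i, hlR i⟩ with hν
  have hν1 : IsProbabilityMeasure ν := by
    constructor
    rw [hν, Measure.coe_finsetSum, Finset.sum_apply]
    simp only [Measure.smul_apply, measure_univ, smul_eq_mul, mul_one]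
    rw [← ENNReal.ofReal_sum_of_nonneg (fun i _ => by positivity), hsum, ENNReal.ofReal_one]
  -- The hypotheses say `x = F(T) e` and `y = G(T) e` in eigencoordinates, which covers polynomials
  -- and the resolvent at once.
  have hint : ∀ F G : ℝ → ℂ, ∀ x y : E, (∀ i, inner ℂ (b i) x = F (l i) * inner ℂ (b i) e) →
      (∀ i, inner ℂ (b i) y = G (l i) * inner ℂ (b i) e) →
      ∫ w : Set.Icc (-R) R, (starRingEnd ℂ) (F w) * G w ∂ν = inner ℂ x y := by
    intro F G x y hx hy
    rw [hν, integral_finsetSum_measure]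
    · rw [← b.sum_inner_mul_inner x y]
      refine Finset.sum_congr rfl fun i _ => ?_
      rw [integral_smul_measure, integral_dirac, hy, ← inner_conj_symm x (b i), hx,
        ENNReal.toReal_ofReal (by positivity), Complex.real_smul,
        Complex.ofReal_pow, ← Complex.conj_mul', map_mul]
      ring
    · intro i _
      exact (integrable_dirac enorm_lt_top).smul_measure ENNReal.ofReal_ne_top
  have hsymm : ∀ i y, inner ℂ (b i) (T y) = (l i : ℂ) * inner ℂ (b i) y := by
    intro i y
    rw [← hT (b i) y, hTb, inner_smul_left, Complex.conj_ofReal]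
  have hpoly : ∀ (p : ℂ[X]) i, inner ℂ (b i) (aeval T p e) = p.eval (l i : ℂ) * inner ℂ (b i) e := by
    intro p i
    induction p using Polynomial.induction_on' with
    | add p q hp hq => simp [hp, hq, add_mul]
    | monomial k a =>
      rw [aeval_monomial, eval_monomial, Module.End.mul_apply, Module.algebraMap_end_apply,
        inner_smul_right, mul_assoc]
      congr 1
      induction k with
      | zero => simp
      | succ k ih => rw [pow_succ', Module.End.mul_apply, hsymm, ih]; ring
  refine ⟨⟨ν, hν1⟩, fun p q => hint (fun x => p.eval (x : ℂ)) (fun x => q.eval (x : ℂ)) _ _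
    (hpoly p) (hpoly q), fun z hz y hy => ?_⟩
  · have h1 := hint (fun _ => 1) (fun x => 1 / (z - (x : ℂ))) e y (by simp) fun i => ?_
    · simpa using h1
    have hne : z - (l i : ℂ) ≠ 0 := by
      intro h
      rw [sub_eq_zero.1 h, Complex.norm_real, Real.norm_eq_abs] at hz
      exact absurd (abs_le.2 (hlR i)) (not_le.2 hz)
    rw [← hy, inner_sub_right, inner_smul_right, hsymm]
    field_simp

end SpectralMeasure

/-! ### Weak compactness. -/

section WeakLimit

/-- Probability measures on a compact interval have weak limits along every ultrafilter. -/
theorem exists_weakLimit {a b : ℝ} {ι : Type*} (ν : ι → ProbabilityMeasure (Set.Icc a b))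
    (U : Ultrafilter ι) :
    ∃ ν' : Measure ℝ, IsProbabilityMeasure ν' ∧ ν' (Set.Icc a b)ᶜ = 0 ∧
      ∀ F : ℝ → ℂ, ContinuousOn F (Set.Icc a b) → Integrable F ν' ∧
        Tendsto (fun i => ∫ w, F w ∂(ν i : Measure (Set.Icc a b))) U (𝓝 (∫ w, F w ∂ν')) := by
  obtain ⟨σ, -, hσ⟩ := isCompact_univ.ultrafilter_le_nhds (U.map ν) (by simp)
  have hσ' : Tendsto ν U (𝓝 σ) := hσ
  rw [ProbabilityMeasure.tendsto_iff_forall_integral_rclike_tendsto ℂ] at hσ'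
  have hem : MeasurableEmbedding (Subtype.val : Set.Icc a b → ℝ) :=
    MeasurableEmbedding.subtype_coe measurableSet_Icc
  refine ⟨(σ : Measure (Set.Icc a b)).map Subtype.val,
    Measure.isProbabilityMeasure_map hem.measurable.aemeasurable, ?_, fun F hF => ?_⟩
  · rw [hem.map_apply]; simp
  · have hc : Continuous (fun w : Set.Icc a b => F w) := hF.domRestrict
    let G := BoundedContinuousFunction.mkOfCompact ⟨_, hc⟩
    refine ⟨hem.integrable_map_iff.2 (G.integrable _), ?_⟩
    rw [hem.integral_map]
    exact hσ' G

theorem support_subset_Icc {ν : Measure ℝ} {a b : ℝ} (h : ν (Set.Icc a b)ᶜ = 0) :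
    ν.support ⊆ Set.Icc a b :=
  Measure.support_subset_of_isClosed isClosed_Icc h

end WeakLimit

theorem inner_normalized {E : Type*} [NormedAddCommGroup E] [InnerProductSpace ℂ E] {v w : E}
    (hv : v ≠ 0) {a b : ℂ} (h : inner ℂ v w = a * (‖v‖ : ℂ) ^ 2) :
    inner ℂ ((‖v‖ : ℂ)⁻¹ • v) (((‖v‖ : ℂ)⁻¹ * b⁻¹) • w) = a / b := by
  have hc : (‖v‖ : ℂ) ≠ 0 := by exact_mod_cast norm_ne_zero_iff.2 hv
  rw [inner_smul_left, inner_smul_right, h, map_inv₀, Complex.conj_ofReal]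
  field_simp

/-! ### Truncations of multiplication by `z` and the ratio as a resolvent entry. -/

section Truncation

variable {μ : Measure ℂ} [IsFiniteMeasure μ]

/-- Polynomials of degree less than `n`, as a subspace of `L²(μ)`. -/
def polySubspace (hμ : IsCompact μ.support) (n : ℕ) : Submodule ℂ (Lp ℂ 2 μ) :=
  (degreeLT ℂ n).map (polyLp hμ)

instance (hμ : IsCompact μ.support) (n : ℕ) : FiniteDimensional ℂ (polySubspace hμ n) := by
  have : FiniteDimensional ℂ (degreeLT ℂ n) := (degreeLTEquiv ℂ n).symm.finiteDimensional
  unfold polySubspace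
  infer_instance

theorem polyLp_mem_polySubspace (hμ : IsCompact μ.support) {n : ℕ} {Q : ℂ[X]}
    (hQ : Q.degree < n) : polyLp hμ Q ∈ polySubspace hμ n :=
  Submodule.mem_map_of_mem (mem_degreeLT.2 hQ)

/-- The compression of multiplication by `z` to polynomials of degree less than `n`. -/
def truncation (hμ : IsCompact μ.support) (n : ℕ) :
    polySubspace hμ n →ₗ[ℂ] polySubspace hμ n :=
  (((polySubspace hμ n).orthogonalProjectionOnto).toLinearMap ∘ₗ (mulZ μ hμ).toLinearMap) ∘ₗ
    (polySubspace hμ n).subtype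

theorem coe_truncation (hμ : IsCompact μ.support) (n : ℕ) (w : polySubspace hμ n) :
    (truncation hμ n w : Lp ℂ 2 μ) = (polySubspace hμ n).starProjection (mulZ μ hμ w) := rfl

theorem isSymmetric_truncation (hμ : IsCompact μ.support)
    (hr : μ.support ⊆ Set.range (fun x : ℝ => (x : ℂ))) (n : ℕ) :
    (truncation hμ n).IsSymmetric := by
  intro v w
  rw [Submodule.coe_inner, Submodule.coe_inner, coe_truncation, coe_truncation,
    Submodule.inner_starProjection_left_eq_right, Submodule.starProjection_eq_self_iff.2 w.2,
    inner_mulZ_left hμ hr, ← Submodule.inner_starProjection_left_eq_right,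
    Submodule.starProjection_eq_self_iff.2 v.2]

theorem norm_truncation_le (hμ : IsCompact μ.support) (n : ℕ) (w : polySubspace hμ n) :
    ‖truncation hμ n w‖ ≤ ‖mulZ μ hμ‖ * ‖w‖ := by
  rw [Submodule.coe_norm, coe_truncation]
  exact (Submodule.norm_starProjection_apply_le _ _).trans ((mulZ μ hμ).le_opNorm _)

theorem norm_le_of_truncation_eq_smul (hμ : IsCompact μ.support) {n : ℕ} {w : polySubspace hμ n}
    (hw : w ≠ 0) {z : ℂ} (h : truncation hμ n w = z • w) : ‖z‖ ≤ ‖mulZ μ hμ‖ := by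
  have h1 := norm_truncation_le hμ n w
  rw [h, norm_smul] at h1
  exact le_of_mul_le_mul_right h1 (norm_pos_iff.2 hw)

/-- The Christoffel–Darboux quotient solves a resolvent equation for the truncation. -/
theorem exists_resolvent_truncation (hμ : IsCompact μ.support) (hinf : μ.support.Infinite)
    (n : ℕ) (z : ℂ) :
    ∃ q : ℂ[X], ∃ _ : q.degree < (n + 1 : ℕ), q.coeff n = (monicOP μ n).eval z ∧
      ∀ w : polySubspace hμ (n + 1), (w : Lp ℂ 2 μ) = polyLp hμ q →
        ((z • w - truncation hμ (n + 1) w : polySubspace hμ (n + 1)) : Lp ℂ 2 μ) =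
          (monicOP μ (n + 1)).eval z • polyLp hμ (monicOP μ n) := by
  set A := monicOP μ n with hA
  set B := monicOP μ (n + 1) with hB
  have hAd : A.natDegree = n := natDegree_monicOP μ n
  have hBd : B.natDegree = n + 1 := natDegree_monicOP μ (n + 1)
  -- Thus `(z - X) q = B(z) A - A(z) B`; projecting to degree at most `n` kills `B` and leaves a
  -- multiple of `A`.
  obtain ⟨q, hq⟩ : X - C z ∣ C (A.eval z) * B - C (B.eval z) * A := by
    rw [dvd_iff_isRoot]; simp [mul_comm]
  have hNd : (C (A.eval z) * B - C (B.eval z) * A).natDegree ≤ n + 1 := by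
    refine (natDegree_sub_le _ _).trans (max_le ?_ ?_)
    · exact (natDegree_C_mul_le _ _).trans hBd.le
    · exact (natDegree_C_mul_le _ _).trans (by omega)
  have hqd : q.natDegree ≤ n := by
    rcases eq_or_ne q 0 with rfl | h0
    · simp
    · have := (monic_X_sub_C z).natDegree_mul' h0
      rw [← hq, natDegree_X_sub_C] at this
      omega
  have hqdeg : q.degree < (n + 1 : ℕ) :=
    lt_of_le_of_lt degree_le_natDegree (by exact_mod_cast Nat.lt_succ_of_le hqd)
  have hAdeg : A.degree < (n + 1 : ℕ) :=
    lt_of_le_of_lt degree_le_natDegree (by rw [hAd]; exact_mod_cast Nat.lt_succ_self n)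
  have hqc : q.coeff n = A.eval z := by
    have h := congrArg (fun p => p.coeff (n + 1)) hq
    have h1 : B.coeff (n + 1) = 1 := by
      have := (monic_monicOP μ (n + 1)).coeff_natDegree
      rwa [natDegree_monicOP] at this
    have h2 : A.coeff (n + 1) = 0 := coeff_eq_zero_of_natDegree_lt (by omega)
    have h3 : q.coeff (n + 1) = 0 := coeff_eq_zero_of_natDegree_lt (by omega)
    simp only [coeff_sub, coeff_C_mul, sub_mul, coeff_X_mul, h1, h2, h3] at h
    simpa using h.symm
  refine ⟨q, hqdeg, hqc, fun w hw => ?_⟩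
  have hBorth : (polySubspace hμ (n + 1)).starProjection (polyLp hμ B) = 0 := by
    rw [Submodule.starProjection_apply_eq_zero_iff, Submodule.mem_orthogonal]
    rintro u ⟨Q, hQ, rfl⟩
    rw [inner_polyLp]
    exact polyInner_monicOP_of_degree_lt hμ hinf (mem_degreeLT.1 hQ)
  have h1 : z • polyLp hμ q - mulZ μ hμ (polyLp hμ q) =
      B.eval z • polyLp hμ A - A.eval z • polyLp hμ B := by
    rw [mulZ_polyLp, ← map_smul, ← map_smul, ← map_smul, ← map_sub, ← map_sub]
    congr 1
    simp only [smul_eq_C_mul]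
    linear_combination hq
  rw [Submodule.coe_sub, Submodule.coe_smul, coe_truncation, hw]
  have h2 := Submodule.starProjection_eq_self_iff.2 (polyLp_mem_polySubspace hμ hqdeg)
  have h3 := Submodule.starProjection_eq_self_iff.2 (polyLp_mem_polySubspace hμ hAdeg)
  have h4 := congrArg (polySubspace hμ (n + 1)).starProjection h1
  rwa [map_sub, map_sub, map_smul, map_smul, map_smul, h2, h3, hBorth, smul_zero, sub_zero] at h4

/-- If `Φ_{n+1}(z) = 0`, the Christoffel–Darboux quotient is an eigenvector of the truncation with
eigenvalue `z`: it is nonzero since its leading coefficient is `Φ_n(z) ≠ 0`. But eigenvalues are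
bounded by `‖ℳ‖`. -/
theorem eval_monicOP_ne_zero (hμ : IsCompact μ.support) (hinf : μ.support.Infinite) {z : ℂ}
    (hz : ‖mulZ μ hμ‖ < ‖z‖) (n : ℕ) : (monicOP μ n).eval z ≠ 0 := by
  induction n with
  | zero =>
    rw [eq_one_of_monic_natDegree_zero (monic_monicOP μ 0) (natDegree_monicOP μ 0)]
    simp
  | succ n ih =>
    intro h0
    obtain ⟨q, hq, hqc, h⟩ := exists_resolvent_truncation hμ hinf n z
    have h1 := h ⟨_, polyLp_mem_polySubspace hμ hq⟩ rfl
    rw [h0, zero_smul, ZeroMemClass.coe_eq_zero, sub_eq_zero] at h1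
    by_cases hw : (⟨_, polyLp_mem_polySubspace hμ hq⟩ : polySubspace hμ (n + 1)) = 0
    · have h2 := eq_zero_of_polyLp_eq_zero hμ hinf (congrArg Subtype.val hw)
      rw [h2, coeff_zero] at hqc
      exact ih hqc.symm
    · exact absurd (norm_le_of_truncation_eq_smul hμ hw h1.symm) (not_le.2 hz)

/-- Ratios of consecutive orthogonal polynomials are Stieltjes transforms. -/
theorem exists_ratioMeasure (hμ : IsCompact μ.support) (hinf : μ.support.Infinite)
    (hr : μ.support ⊆ Set.range (fun x : ℝ => (x : ℂ))) (n : ℕ) :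
    ∃ ν : ProbabilityMeasure (Set.Icc (-‖mulZ μ hμ‖) ‖mulZ μ hμ‖),
      ∀ z : ℂ, ‖mulZ μ hμ‖ < ‖z‖ →
        (monicOP μ n).eval z / (monicOP μ (n + 1)).eval z =
          ∫ w, 1 / (z - ((w : ℝ) : ℂ)) ∂(ν : Measure (Set.Icc (-‖mulZ μ hμ‖) ‖mulZ μ hμ‖)) := by
  have hA0 : polyLp hμ (monicOP μ n) ≠ 0 := fun h =>
    (monic_monicOP μ n).ne_zero (eq_zero_of_polyLp_eq_zero hμ hinf h)
  have hAdeg : (monicOP μ n).degree < (n + 1 : ℕ) :=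
    lt_of_le_of_lt degree_le_natDegree
      (by rw [natDegree_monicOP]; exact_mod_cast Nat.lt_succ_self n)
  set A : polySubspace hμ (n + 1) := ⟨_, polyLp_mem_polySubspace hμ hAdeg⟩ with hA
  have hAne : A ≠ 0 := fun h => hA0 (congrArg Subtype.val h)
  obtain ⟨ν, -, hν⟩ := exists_spectralMeasure (isSymmetric_truncation hμ hr (n + 1))
    (R := ‖mulZ μ hμ‖) (e := (‖A‖ : ℂ)⁻¹ • A)
    (fun x v hv h => by simpa using norm_le_of_truncation_eq_smul hμ hv h)
    (norm_smul_inv_norm hAne)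
  refine ⟨ν, fun z hz => ?_⟩
  obtain ⟨q, hq, hqc, h⟩ := exists_resolvent_truncation hμ hinf n z
  have hB := eval_monicOP_ne_zero hμ hinf hz (n + 1)
  set w : polySubspace hμ (n + 1) := ⟨_, polyLp_mem_polySubspace hμ hq⟩ with hw
  have h1 : z • w - truncation hμ (n + 1) w = (monicOP μ (n + 1)).eval z • A :=
    Subtype.ext (h w rfl)
  rw [hν z hz (((‖A‖ : ℂ)⁻¹ * ((monicOP μ (n + 1)).eval z)⁻¹) • w)]
  -- Only the top coefficient `Φ_n(z)` of `q` matters: `q - Φ_n(z) Φ_n` has degree below `n`, so it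
  -- is orthogonal to `Φ_n`.
  · have h2 : inner ℂ A w = (monicOP μ n).eval z * (‖A‖ : ℂ) ^ 2 := by
      have h0 : inner ℂ A A = (‖A‖ : ℂ) ^ 2 := inner_self_eq_norm_sq_to_K A
      have h3 : (q - q.coeff n • monicOP μ n).degree < n := by
        rw [degree_lt_iff_coeff_zero]
        intro m hm
        rcases hm.eq_or_lt with rfl | hm
        · have := (monic_monicOP μ n).coeff_natDegree
          rw [natDegree_monicOP] at this
          simp [this]
        · have h2 : q.coeff m = 0 := (degree_lt_iff_coeff_zero _ _).1 hq m hm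
          have h3 : (monicOP μ n).coeff m = 0 :=
            coeff_eq_zero_of_natDegree_lt (by rw [natDegree_monicOP]; exact hm)
          simp [h2, h3]
      have h4 := polyInner_monicOP_of_degree_lt hμ hinf h3
      rw [← inner_polyLp hμ, ← inner_conj_symm, map_eq_zero] at h4
      rw [map_sub, map_smul, inner_sub_right, inner_smul_right, sub_eq_zero, hqc] at h4
      rw [← h0]
      exact h4
    exact (inner_normalized hAne h2).symm
  · rw [map_smul, smul_comm z, ← smul_sub, h1, smul_smul]
    congr 1
    field_simp

theorem norm_ratio_le (hμ : IsCompact μ.support) (hinf : μ.support.Infinite)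
    (hr : μ.support ⊆ Set.range (fun x : ℝ => (x : ℂ))) {z : ℂ} (hz : ‖mulZ μ hμ‖ < ‖z‖)
    (n : ℕ) :
    ‖(monicOP μ n).eval z / (monicOP μ (n + 1)).eval z‖ ≤ 1 / (‖z‖ - ‖mulZ μ hμ‖) := by
  obtain ⟨ν, hν⟩ := exists_ratioMeasure hμ hinf hr n
  rw [hν z hz]
  refine (norm_integral_le_of_norm_le_const (C := 1 / (‖z‖ - ‖mulZ μ hμ‖))
    (Eventually.of_forall fun w => ?_)).trans_eq (by simp)
  rw [norm_div, norm_one]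
  have h1 : ‖((w : ℝ) : ℂ)‖ ≤ ‖mulZ μ hμ‖ := by
    rw [Complex.norm_real]; exact abs_le.2 w.2
  have h2 := norm_sub_norm_le z ((w : ℝ) : ℂ)
  exact one_div_le_one_div_of_le (by linarith) (by linarith)

end Truncation

theorem continuousOn_one_div_sub {R : ℝ} {z : ℂ} (hz : R < ‖z‖) :
    ContinuousOn (fun w : ℝ => 1 / (z - (w : ℂ))) (Set.Icc (-R) R) := by
  refine ContinuousOn.div continuousOn_const (by fun_prop) fun w hw h => ?_
  rw [sub_eq_zero.1 h, Complex.norm_real] at hz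
  exact absurd (abs_le.2 hw) (not_le.2 hz)

/-- Subsequential limits of ratios of orthogonal polynomials are Stieltjes transforms. -/
theorem exists_isStieltjesOutside_of_isRatioLimitAlong {μ : Measure ℂ} [IsFiniteMeasure μ]
    (hμ : IsCompact μ.support) (hinf : μ.support.Infinite)
    (hr : μ.support ⊆ Set.range (fun x : ℝ => (x : ℂ))) {N : Set ℕ} {f : ℂ → ℂ}
    (hf : IsRatioLimitAlong μ hμ N f) :
    ∃ ν : Measure ℝ, IsProbabilityMeasure ν ∧ IsCompact ν.support ∧
      IsStieltjesOutside ν ‖mulZ μ hμ‖ f := by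
  have : (atTop ⊓ 𝓟 N).NeBot := by
    rw [← frequently_mem_iff_neBot]
    exact Nat.frequently_atTop_iff_infinite.2 hf.infinite
  let U := Ultrafilter.of (atTop ⊓ 𝓟 N)
  have hU : (U : Filter ℕ) ≤ atTop ⊓ 𝓟 N := Ultrafilter.of_le _
  choose ν hν using exists_ratioMeasure hμ hinf hr
  obtain ⟨σ, h1, h2, h3⟩ := exists_weakLimit (fun n => ν (n - 1)) U
  refine ⟨σ, h1, isCompact_Icc.of_isClosed_subset Measure.isClosed_support
    (support_subset_Icc h2), fun z hz => ?_⟩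
  obtain ⟨h4, h5⟩ := h3 _ (continuousOn_one_div_sub hz)
  refine ⟨h4, tendsto_nhds_unique ((hf.tendsto z hz).mono_left hU) (h5.congr' ?_)⟩
  have h6 : ∀ᶠ n in (U : Filter ℕ), n ∈ N := hU (mem_inf_of_right (mem_principal_self N))
  filter_upwards [h6] with n hn
  have := hν (n - 1) z hz
  rw [Nat.sub_add_cancel (hf.one_le n hn)] at this
  exact this.symm

theorem norm_eq_one_of_inner_self {E : Type*} [NormedAddCommGroup E] [InnerProductSpace ℂ E]
    {v : E} (h : inner ℂ v v = 1) : ‖v‖ = 1 := by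
  rw [norm_eq_sqrt_re_inner (𝕜 := ℂ), h]; simp

/-! ### Jacobi matrices and Favard's theorem. -/

section Favard

/-- Monic polynomials of a three-term recurrence
`P_{n+1} = (X - b_n) P_n - a_n² P_{n-1}` with `P_0 = 1` and `P_1 = X - b_0`. -/
def recurrencePoly (b a : ℕ → ℝ) : ℕ → ℂ[X]
  | 0 => 1
  | 1 => X - C (b 0 : ℂ)
  | n + 2 => (X - C (b (n + 1) : ℂ)) * recurrencePoly b a (n + 1) -
      C ((a (n + 1) : ℂ) ^ 2) * recurrencePoly b a n

theorem recurrencePoly_monic_natDegree (b a : ℕ → ℝ) (n : ℕ) :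
    (recurrencePoly b a n).Monic ∧ (recurrencePoly b a n).natDegree = n := by
  induction n using Nat.twoStepInduction with
  | zero => simp [recurrencePoly]
  | one => exact ⟨monic_X_sub_C _, natDegree_X_sub_C _⟩
  | more n h1 h2 =>
    rw [recurrencePoly]
    have hm := (monic_X_sub_C (b (n + 1) : ℂ)).mul h2.1
    have hd : ((X - C (b (n + 1) : ℂ)) * recurrencePoly b a (n + 1)).natDegree = n + 2 := by
      rw [(monic_X_sub_C _).natDegree_mul h2.1, natDegree_X_sub_C, h2.2]; ring
    have hlt : (C ((a (n + 1) : ℂ) ^ 2) * recurrencePoly b a n).degree <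
        ((X - C (b (n + 1) : ℂ)) * recurrencePoly b a (n + 1)).degree := by
      rw [degree_eq_natDegree hm.ne_zero, hd, ← smul_eq_C_mul]
      refine ((degree_smul_le _ _).trans degree_le_natDegree).trans_lt ?_
      rw [h1.2]
      exact_mod_cast (by omega : n < n + 2)
    exact ⟨hm.sub_of_left hlt, by rw [natDegree_eq_of_degree_eq (degree_sub_eq_left_of_degree_lt hlt), hd]⟩

/-- The truncated Jacobi matrix. -/
def jacobiMatrix (b a : ℕ → ℝ) (N : ℕ) : Matrix (Fin N) (Fin N) ℂ := fun i j =>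
  if (i : ℕ) = j then (b i : ℂ)
  else if (i : ℕ) = j + 1 then (a i : ℂ)
  else if (j : ℕ) = i + 1 then (a j : ℂ) else 0

theorem jacobiMatrix_isHermitian (b a : ℕ → ℝ) (N : ℕ) : (jacobiMatrix b a N).IsHermitian := by
  ext i j
  simp only [Matrix.conjTranspose_apply, jacobiMatrix]
  split_ifs <;> first | omega | simp_all

/-- Gershgorin's theorem: a row has at most two off-diagonal entries. The bound does not depend on
`N`, so all spectral measures live on one compact interval. -/
theorem abs_le_of_jacobiMatrix {b a : ℕ → ℝ} {A B : ℝ} (hb : ∀ n, |b n| ≤ B)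
    (ha : ∀ n, |a n| ≤ A) {N : ℕ} {x : ℝ} {v : EuclideanSpace ℂ (Fin N)} (hv : v ≠ 0)
    (h : Matrix.toEuclideanLin (jacobiMatrix b a N) v = (x : ℂ) • v) : |x| ≤ B + 2 * A := by
  have hA : 0 ≤ A := (abs_nonneg _).trans (ha 0)
  have hev : Module.End.HasEigenvalue (Matrix.toLin' (jacobiMatrix b a N)) (x : ℂ) := by
    refine Module.End.hasEigenvalue_of_hasEigenvector (x := v.ofLp)
      ⟨Module.End.mem_eigenspace_iff.2 ?_, ?_⟩
    · simpa using congrArg WithLp.ofLp h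
    · simpa using hv
  obtain ⟨k, hk⟩ := eigenvalue_mem_ball hev
  rw [mem_closedBall_iff_norm] at hk
  have hone : ∀ p : Fin N → Prop, ∀ [DecidablePred p], (∀ i j, p i → p j → i = j) →
      ∑ j, (if p j then A else 0) ≤ A := by
    intro p _ hp
    rw [← Finset.sum_filter, Finset.sum_const, nsmul_eq_mul]
    have : (Finset.univ.filter p).card ≤ 1 :=
      Finset.card_le_one.2 fun i hi j hj => hp i j (by simpa using hi) (by simpa using hj)
    have : ((Finset.univ.filter p).card : ℝ) ≤ 1 := by exact_mod_cast this
    nlinarith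
  have hsum : ∑ j ∈ Finset.univ.erase k, ‖jacobiMatrix b a N k j‖ ≤ 2 * A := by
    calc ∑ j ∈ Finset.univ.erase k, ‖jacobiMatrix b a N k j‖
        ≤ ∑ j ∈ Finset.univ.erase k,
          ((if (k : ℕ) = j + 1 then A else 0) + (if (j : ℕ) = k + 1 then A else 0)) := by
          refine Finset.sum_le_sum fun j hj => ?_
          have hne : (k : ℕ) ≠ j := fun h => (Finset.mem_erase.1 hj).1 (Fin.ext h.symm)
          rw [jacobiMatrix, if_neg hne]
          split_ifs <;> first | omega | simp [ha]
      _ ≤ ∑ j : Fin N,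
          ((if (k : ℕ) = j + 1 then A else 0) + (if (j : ℕ) = k + 1 then A else 0)) :=
          Finset.sum_le_sum_of_subset_of_nonneg (Finset.subset_univ _)
            fun j _ _ => by positivity
      _ ≤ 2 * A := by
          rw [Finset.sum_add_distrib]
          have h1 := hone (fun j => (k : ℕ) = j + 1) (fun i j hi hj => Fin.ext (by omega))
          have h2 := hone (fun j => (j : ℕ) = k + 1) (fun i j hi hj => Fin.ext (by omega))
          linarith
  have hd : ‖jacobiMatrix b a N k k‖ ≤ B := by
    rw [jacobiMatrix, if_pos rfl, Complex.norm_real]; exact hb _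
  have h1 := norm_sub_norm_le (x : ℂ) (jacobiMatrix b a N k k)
  rw [Complex.norm_real, Real.norm_eq_abs] at h1
  linarith

/-- The standard basis vectors, extended by zero. -/
def stdVec (N k : ℕ) : EuclideanSpace ℂ (Fin N) :=
  WithLp.toLp 2 fun i => if (i : ℕ) = k then 1 else 0

theorem toEuclideanLin_stdVec_apply {N : ℕ} (M : Matrix (Fin N) (Fin N) ℂ) {k : ℕ} (hk : k < N)
    (i : Fin N) : Matrix.toEuclideanLin M (stdVec N k) i = M i ⟨k, hk⟩ := by
  rw [Matrix.toLpLin_apply]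
  simp only [stdVec, Matrix.mulVec, dotProduct]
  rw [Finset.sum_eq_single ⟨k, hk⟩]
  · simp
  · intro j _ hj
    rw [if_neg (fun h => hj (Fin.ext h)), mul_zero]
  · simp

theorem jacobiMatrix_stdVec_zero (b a : ℕ → ℝ) {N : ℕ} (hN : 0 < N) :
    Matrix.toEuclideanLin (jacobiMatrix b a N) (stdVec N 0) =
      (b 0 : ℂ) • stdVec N 0 + (a 1 : ℂ) • stdVec N 1 := by
  ext i
  rw [toEuclideanLin_stdVec_apply _ hN]
  simp only [jacobiMatrix, stdVec, PiLp.add_apply, PiLp.smul_apply, smul_eq_mul]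
  split_ifs <;> first | omega | simp_all

/-- In the last column, `k + 2 = N`, the final term vanishes because `stdVec N N = 0`. -/
theorem jacobiMatrix_stdVec_succ (b a : ℕ → ℝ) {N k : ℕ} (hk : k + 1 < N) :
    Matrix.toEuclideanLin (jacobiMatrix b a N) (stdVec N (k + 1)) =
      (a (k + 1) : ℂ) • stdVec N k + (b (k + 1) : ℂ) • stdVec N (k + 1) +
        (a (k + 2) : ℂ) • stdVec N (k + 2) := by
  ext i
  rw [toEuclideanLin_stdVec_apply _ hk]
  simp only [jacobiMatrix, stdVec, PiLp.add_apply, PiLp.smul_apply, smul_eq_mul]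
  split_ifs <;> first | omega | simp_all

theorem aeval_recurrencePoly (b a : ℕ → ℝ) {N k : ℕ} (hk : k < N) :
    aeval (Matrix.toEuclideanLin (jacobiMatrix b a N)) (recurrencePoly b a k) (stdVec N 0) =
      (∏ i ∈ Finset.range k, (a (i + 1) : ℂ)) • stdVec N k := by
  induction k using Nat.twoStepInduction with
  | zero => simp [recurrencePoly]
  | one =>
    simp [recurrencePoly, jacobiMatrix_stdVec_zero b a (by omega : 0 < N)]
  | more k h1 h2 =>
    rw [recurrencePoly, map_sub, map_mul, map_mul, map_sub, aeval_X, aeval_C, aeval_C,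
      LinearMap.sub_apply, Module.End.mul_apply, Module.End.mul_apply, h1 (by omega),
      h2 (by omega), LinearMap.sub_apply, Module.algebraMap_end_apply,
      Module.algebraMap_end_apply, map_smul, jacobiMatrix_stdVec_succ b a (by omega),
      Finset.prod_range_succ _ (k + 1), Finset.prod_range_succ _ k]
    module

theorem inner_stdVec {N j k : ℕ} (hj : j < N) :
    inner ℂ (stdVec N j) (stdVec N k) = if j = k then 1 else 0 := by
  rw [PiLp.inner_apply, Finset.sum_eq_single ⟨j, hj⟩]
  · simp [stdVec]
  · intro i _ hi
    have : (i : ℕ) ≠ j := fun h => hi (Fin.ext h)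
    simp [stdVec, this]
  · simp

/-- **Favard's theorem** for bounded recurrence coefficients. -/
theorem exists_measure_of_recurrence {b a : ℕ → ℝ} {A B : ℝ} (hb : ∀ n, |b n| ≤ B)
    (ha : ∀ n, |a n| ≤ A) (ha0 : ∀ n, a n ≠ 0) :
    ∃ μ : Measure ℂ, IsProbabilityMeasure μ ∧ IsCompact μ.support ∧ μ.support.Infinite ∧
      μ.support ⊆ Set.range (fun x : ℝ => (x : ℂ)) ∧ ∀ n, monicOP μ n = recurrencePoly b a n := by
  set P := recurrencePoly b a with hPdef
  have hPm : ∀ n, (P n).Monic := fun n => (recurrencePoly_monic_natDegree b a n).1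
  have hPd : ∀ n, (P n).natDegree = n := fun n => (recurrencePoly_monic_natDegree b a n).2
  have hν : ∀ N : ℕ, ∃ ν : ProbabilityMeasure (Set.Icc (-(B + 2 * A)) (B + 2 * A)),
      ∀ j k, j < N + 1 → k < N + 1 →
      ∫ w, (starRingEnd ℂ) ((P j).eval ((w : ℝ) : ℂ)) * (P k).eval ((w : ℝ) : ℂ)
        ∂(ν : Measure (Set.Icc (-(B + 2 * A)) (B + 2 * A))) =
      if j = k then ∏ i ∈ Finset.range j, (a (i + 1) : ℂ) ^ 2 else 0 := by
    intro N
    have he : ‖stdVec (N + 1) 0‖ = 1 :=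
      norm_eq_one_of_inner_self (by rw [inner_stdVec (by omega), if_pos rfl])
    obtain ⟨ν, h, -⟩ := exists_spectralMeasure
      (Matrix.isSymmetric_toEuclideanLin_iff.2 (jacobiMatrix_isHermitian b a (N + 1)))
      (fun x v hv h => abs_le_of_jacobiMatrix hb ha hv h) he
    refine ⟨ν, fun j k hj hk => ?_⟩
    rw [h, aeval_recurrencePoly b a hj, aeval_recurrencePoly b a hk, inner_smul_left,
      inner_smul_right, inner_stdVec hj]
    split_ifs with hjk
    · subst hjk
      simp [map_prod, sq, Finset.prod_mul_distrib]
    · simp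
  choose ν hν using hν
  let U : Ultrafilter ℕ := Ultrafilter.of atTop
  have hU : (U : Filter ℕ) ≤ atTop := Ultrafilter.of_le _
  obtain ⟨σ, h1, h2, h3⟩ := exists_weakLimit ν U
  have hem : MeasurableEmbedding (fun x : ℝ => (x : ℂ)) :=
    Complex.isometry_ofReal.isClosedEmbedding.measurableEmbedding
  set μ : Measure ℂ := σ.map (fun x : ℝ => (x : ℂ)) with hμdef
  have hprob : IsProbabilityMeasure μ :=
    Measure.isProbabilityMeasure_map hem.measurable.aemeasurable
  have hinner : ∀ j k, polyInner μ (P j) (P k) =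
      if j = k then ∏ i ∈ Finset.range j, (a (i + 1) : ℂ) ^ 2 else 0 := by
    intro j k
    rw [polyInner, hμdef, hem.integral_map]
    have h4 := (h3 (fun x => (starRingEnd ℂ) ((P j).eval (x : ℂ)) * (P k).eval (x : ℂ))
      (by fun_prop)).2
    refine tendsto_nhds_unique h4 (tendsto_const_nhds.congr' ?_)
    -- The integrals are exact, not just convergent, once the matrix has more than `max j k` rows.
    filter_upwards [hU (eventually_ge_atTop (max j k))] with N hN
    rw [hν N j k (by omega) (by omega)]
  have hsub : μ.support ⊆ (fun x : ℝ => (x : ℂ)) '' Set.Icc (-(B + 2 * A)) (B + 2 * A) := by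
    refine Measure.support_subset_of_isClosed
      ((isCompact_Icc.image Complex.continuous_ofReal).isClosed) ?_
    rw [mem_ae_iff, hμdef, hem.map_apply]
    convert h2 using 2
    ext x
    simp
  have hcomp : IsCompact μ.support :=
    (isCompact_Icc.image Complex.continuous_ofReal).of_isClosed_subset
      Measure.isClosed_support hsub
  have horth : ∀ n : ℕ, ∀ R : ℂ[X], R.degree < (n : WithBot ℕ) → polyInner μ R (P n) = 0 := fun n R hR =>
    polyInner_eq_zero_of_forall_lt hcomp hPm hPd
      (fun k hk => by rw [hinner, if_neg hk.ne]) hR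
  -- On a finite support, the monic `Q` vanishing there is zero in `L²`. Since `Q - P n` has lower
  -- degree than `P n`, this forces `P n` to have norm zero, against `a ≠ 0`.
  have hinf : μ.support.Infinite := by
    intro hfin
    set Q : ℂ[X] := ∏ x ∈ hfin.toFinset, (X - C x) with hQ
    have hQm : Q.Monic := monic_prod_of_monic _ _ fun x _ => monic_X_sub_C x
    have hQ0 : polyLp hcomp Q = 0 := by
      refine Lp.ext ?_
      filter_upwards [coeFn_polyLp hcomp Q, Lp.coeFn_zero ℂ 2 μ,
        Measure.support_mem_ae (μ := μ)] with z h4 h5 h6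
      rw [h4, h5, hQ, eval_prod]
      exact Finset.prod_eq_zero (hfin.mem_toFinset.2 h6) (by simp)
    set n := Q.natDegree with hn
    have hdeg : (Q - P n).degree < n := by
      rw [← degree_eq_natDegree hQm.ne_zero]
      refine degree_sub_lt_left ?_ hQm.ne_zero ?_
      · rw [degree_eq_natDegree hQm.ne_zero, degree_eq_natDegree (hPm n).ne_zero, hPd]
      · rw [hQm.leadingCoeff, (hPm n).leadingCoeff]
    have h4 := horth n _ hdeg
    rw [← inner_polyLp hcomp, map_sub, hQ0, zero_sub, inner_neg_left, neg_eq_zero,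
      inner_polyLp, hinner, if_pos rfl, Finset.prod_eq_zero_iff] at h4
    obtain ⟨i, -, hi⟩ := h4
    exact ha0 (i + 1) (by simpa using hi)
  exact ⟨μ, hprob, hcomp, hinf, hsub.trans (Set.image_subset_range _ _), fun n =>
    eq_monicOP hcomp hinf (hPm n) (hPd n) (horth n)⟩

/-- Orthogonality of `Φ_1` to `1` identifies `x` with the mean `⟨1, ℳ 1⟩`, and `1` is a unit vector.
-/
theorem abs_le_norm_mulZ {μ : Measure ℂ} [IsProbabilityMeasure μ] (hμ : IsCompact μ.support)
    (hinf : μ.support.Infinite) {x : ℝ} (hx : monicOP μ 1 = X - C (x : ℂ)) :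
    |x| ≤ ‖mulZ μ hμ‖ := by
  have h1 : polyInner μ 1 (monicOP μ 1) = 0 :=
    polyInner_monicOP_of_degree_lt hμ hinf (by simp)
  have h11 : inner ℂ (polyLp hμ 1) (polyLp hμ 1) = 1 := by
    rw [inner_polyLp, polyInner]; simp
  have hn : ‖polyLp hμ 1‖ = 1 := norm_eq_one_of_inner_self h11
  have h2 : inner ℂ (polyLp hμ 1) (mulZ μ hμ (polyLp hμ 1)) = (x : ℂ) := by
    have hC : C (x : ℂ) = (x : ℂ) • (1 : ℂ[X]) := by rw [smul_eq_C_mul, mul_one]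
    rw [hx, ← inner_polyLp hμ, map_sub, inner_sub_right, hC, map_smul, inner_smul_right, h11,
      mul_one, sub_eq_zero] at h1
    rw [mulZ_polyLp, mul_one, h1]
  have h3 := norm_inner_le_norm (𝕜 := ℂ) (polyLp hμ 1) (mulZ μ hμ (polyLp hμ 1))
  have h4 := (mulZ μ hμ).le_opNorm (polyLp hμ 1)
  rw [h2, Complex.norm_real, hn, one_mul] at h3
  rw [hn, mul_one] at h4
  exact h3.trans h4

end Favard

/-! ### Resolvent functions and their continued fractions. -/

section Schur

variable {H : Type*} [NormedAddCommGroup H] [InnerProductSpace ℂ H]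

/-- With `x = 0` this also gives uniqueness of resolvent solutions. -/
theorem norm_le_of_resolvent {A : H →L[ℂ] H} {R : ℝ} (hA : ‖A‖ ≤ R) {z : ℂ} (hz : R < ‖z‖)
    {x y : H} (h : z • y - A y = x) : ‖y‖ ≤ ‖x‖ / (‖z‖ - R) := by
  rw [le_div_iff₀ (by linarith)]
  have h1 := norm_sub_norm_le (z • y) (A y)
  rw [h, norm_smul] at h1
  have h2 : ‖A y‖ ≤ R * ‖y‖ := A.le_of_opNorm_le hA y
  nlinarith

theorem exists_resolvent [CompleteSpace H] {A : H →L[ℂ] H} {R : ℝ} (hA : ‖A‖ ≤ R) {z : ℂ}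
    (hz : R < ‖z‖) (x : H) : ∃ y, z • y - A y = x := by
  rcases subsingleton_or_nontrivial H with _ | _
  · exact ⟨0, Subsingleton.elim _ _⟩
  have h : z ∈ resolventSet ℂ A :=
    spectrum.mem_resolventSet_of_norm_lt_mul (by rw [norm_one, mul_one]; linarith)
  obtain ⟨u, hu⟩ := spectrum.mem_resolventSet_iff.1 h
  refine ⟨(↑u⁻¹ : H →L[ℂ] H) x, ?_⟩
  have h1 : (u : H →L[ℂ] H) ((↑u⁻¹ : H →L[ℂ] H) x) = x := by
    rw [← mul_apply_eq_comp, u.mul_inv]; rfl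
  rw [hu] at h1
  simpa [Algebra.algebraMap_eq_smul_one] using h1

/-- `(A, e, G)` where `A` is symmetric of norm at most `R`, `e` a unit vector, and
`G z = ⟨e, (z - A)⁻¹ e⟩` for `|z| > R`. -/
structure IsResolventFunction (R : ℝ) (A : H →L[ℂ] H) (e : H) (G : ℂ → ℂ) : Prop where
  symm : ∀ x y, inner ℂ (A x) y = inner ℂ x (A y)
  norm_le : ‖A‖ ≤ R
  norm_vec : ‖e‖ = 1
  eq_inner : ∀ z : ℂ, R < ‖z‖ → ∀ y, z • y - A y = e → G z = inner ℂ e y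

theorem IsResolventFunction.norm_apply_le [CompleteSpace H] {R : ℝ} {A : H →L[ℂ] H} {e : H}
    {G : ℂ → ℂ} (h : IsResolventFunction R A e G) {z : ℂ} (hz : R < ‖z‖) :
    ‖G z‖ ≤ 1 / (‖z‖ - R) := by
  obtain ⟨y, hy⟩ := exists_resolvent h.norm_le hz e
  rw [h.eq_inner z hz y hy]
  refine (norm_inner_le_norm _ _).trans ?_
  have := norm_le_of_resolvent h.norm_le hz hy
  rw [h.norm_vec] at this ⊢
  rwa [one_mul]

theorem exists_isResolventFunction [CompleteSpace H] {R : ℝ} {A : H →L[ℂ] H} {e : H}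
    (hs : ∀ x y, inner ℂ (A x) y = inner ℂ x (A y)) (hA : ‖A‖ ≤ R) (he : ‖e‖ = 1) :
    ∃ G, IsResolventFunction R A e G := by
  have h : ∀ z : ℂ, ∃ y, R < ‖z‖ → z • y - A y = e := fun z => by
    by_cases hz : R < ‖z‖
    · obtain ⟨y, hy⟩ := exists_resolvent hA hz e
      exact ⟨y, fun _ => hy⟩
    · exact ⟨0, fun h => absurd h hz⟩
  choose y hy using h
  refine ⟨fun z => inner ℂ e (y z), hs, hA, he, fun z hz x hx => ?_⟩
  have h1 : z • (y z - x) - A (y z - x) = 0 := by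
    rw [smul_sub, map_sub, sub_sub_sub_comm, hy z hz, hx, sub_self]
  have h2 := norm_le_of_resolvent hA hz h1
  rw [norm_zero, zero_div, norm_le_zero_iff, sub_eq_zero] at h2
  simp [h2]

/-- One step of the continued fraction expansion of a resolvent function, obtained from the Schur
complement with respect to the cyclic vector. -/
theorem IsResolventFunction.exists_step [CompleteSpace H] {R : ℝ} {A : H →L[ℂ] H} {e : H}
    {G : ℂ → ℂ} (h : IsResolventFunction R A e G) :
    ∃ (A' : H →L[ℂ] H) (e' : H) (G' : ℂ → ℂ) (β α : ℝ), IsResolventFunction R A' e' G' ∧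
      |β| ≤ R ∧ |α| ≤ R ∧
      ∀ z : ℂ, R < ‖z‖ → G z * (z - β - (α : ℂ) ^ 2 * G' z) = 1 := by
  have hR : 0 ≤ R := (norm_nonneg _).trans h.norm_le
  -- The complement is represented by `Q A Q` on all of `H` rather than on `eᗮ`, so the step can be
  -- iterated on one space.
  set Q : H →L[ℂ] H := (ℂ ∙ e)ᗮ.starProjection with hQ
  have hQe : ∀ x, Q x = x - (inner ℂ e x : ℂ) • e := by
    intro x
    rw [hQ, Submodule.starProjection_orthogonal']
    simp [Submodule.starProjection_unit_singleton ℂ h.norm_vec]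
  have hQn : ‖Q‖ ≤ 1 := Submodule.starProjection_norm_le _
  have hQs : ∀ x y, inner ℂ (Q x) y = inner ℂ x (Q y) := fun x y =>
    Submodule.inner_starProjection_left_eq_right _ x y
  have hee : inner ℂ e e = 1 := by
    rw [inner_self_eq_norm_sq_to_K, h.norm_vec]; simp
  set β : ℝ := (inner ℂ e (A e) : ℂ).re with hβ
  have hβc : (β : ℂ) = inner ℂ e (A e) := by
    rw [hβ, ← Complex.conj_eq_iff_re, inner_conj_symm, h.symm]
  have hAe : ‖A e‖ ≤ R := by
    have := A.le_of_opNorm_le h.norm_le e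
    rwa [h.norm_vec, mul_one] at this
  have hβR : |β| ≤ R := by
    rw [← Real.norm_eq_abs, ← Complex.norm_real, hβc]
    refine (norm_inner_le_norm _ _).trans ?_
    rwa [h.norm_vec, one_mul]
  set v := Q (A e) with hv
  have hvA : A e = v + (β : ℂ) • e := by rw [hv, hQe, hβc]; simp
  set α := ‖v‖ with hα
  have hαR : |α| ≤ R := by
    rw [abs_of_nonneg (norm_nonneg _)]
    have := Q.le_of_opNorm_le hQn (A e)
    rw [one_mul] at this
    exact this.trans hAe
  -- If `v = 0` the continued fraction terminates: `α = 0` and any unit vector serves.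
  obtain ⟨e', he', hve'⟩ : ∃ e' : H, ‖e'‖ = 1 ∧ v = (α : ℂ) • e' := by
    rcases eq_or_ne v 0 with h0 | h0
    · exact ⟨e, h.norm_vec, by rw [hα, h0]; simp⟩
    · refine ⟨(α : ℂ)⁻¹ • v, norm_smul_inv_norm h0, ?_⟩
      rw [smul_smul, mul_inv_cancel₀ (by exact_mod_cast norm_ne_zero_iff.2 h0), one_smul]
  have hA's : ∀ x y, inner ℂ ((Q * A * Q) x) y = inner ℂ x ((Q * A * Q) y) := by
    intro x y
    simp only [mul_apply_eq_comp]
    rw [hQs, h.symm, hQs]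
  have hA'n : ‖Q * A * Q‖ ≤ R := by
    calc ‖Q * A * Q‖ ≤ ‖Q‖ * ‖A‖ * ‖Q‖ :=
          (norm_mul_le _ _).trans (by gcongr; exact norm_mul_le _ _)
      _ ≤ 1 * R * 1 := by gcongr; exact h.norm_le
      _ = R := by ring
  obtain ⟨G', hG'⟩ := exists_isResolventFunction hA's hA'n he'
  refine ⟨_, e', G', β, α, hG', hβR, hαR, fun z hz => ?_⟩
  have hz0 : z ≠ 0 := by
    rintro rfl; rw [norm_zero] at hz; linarith
  obtain ⟨x, hx⟩ := exists_resolvent hA'n hz e'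
  obtain ⟨w, hw⟩ := exists_resolvent h.norm_le hz e
  obtain ⟨y, hy⟩ : ∃ y, y = (α : ℂ) • x := ⟨_, rfl⟩
  have hy' : z • y - Q (A (Q y)) = v := by
    rw [hve', ← hx, smul_sub, hy, smul_comm z]
    simp
  have heQ : ∀ x, inner ℂ e (Q x) = 0 := fun x => by
    rw [hQe, inner_sub_right, inner_smul_right, hee, mul_one, sub_self]
  have hey : inner ℂ e y = 0 := by
    have h1 := congrArg (inner ℂ e) hy'
    rw [heQ, inner_sub_right, inner_smul_right, heQ, sub_zero] at h1
    exact (mul_eq_zero.1 h1).resolve_left hz0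
  have hQy : Q y = y := by rw [hQe, hey, zero_smul, sub_zero]
  have hαG : (α : ℂ) ^ 2 * G' z = inner ℂ v y := by
    rw [hG'.eq_inner z hz x hx, hve', hy, inner_smul_left, inner_smul_right, Complex.conj_ofReal]
    ring
  have heAy : inner ℂ e (A y) = inner ℂ v y := by
    rw [← h.symm, hvA, inner_add_left, inner_smul_left, hey, mul_zero, add_zero]
  rw [hαG]
  set s : ℂ := z - β - inner ℂ v y with hs
  -- Block elimination: `e + y` solves the resolvent equation up to the scalar `s`. Hence `e + y = s
  -- w`, and pairing with `e` gives `1 = s G(z)`.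
  have hsum : z • (e + y) - A (e + y) = s • e := by
    rw [hQy, hQe, heAy] at hy'
    rw [map_add, hvA, hs]
    generalize inner ℂ v y = t at hy' ⊢
    rw [← hy']
    module
  have h1 : z • ((e + y) - s • w) - A ((e + y) - s • w) = 0 := by
    rw [smul_sub, map_sub, sub_sub_sub_comm, hsum, map_smul, smul_comm z, ← smul_sub, hw, sub_self]
  have h2 := norm_le_of_resolvent h.norm_le hz h1
  rw [norm_zero, zero_div, norm_le_zero_iff, sub_eq_zero] at h2
  rw [h.eq_inner z hz w hw, mul_comm, ← inner_smul_right, ← h2, inner_add_right, hee, hey,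
    add_zero]

/-- Continued fraction expansion of a resolvent function. -/
theorem IsResolventFunction.exists_continuedFraction [CompleteSpace H] {R : ℝ} {A : H →L[ℂ] H}
    {e : H} {G : ℂ → ℂ} (h : IsResolventFunction R A e G) :
    ∃ (g : ℕ → ℂ → ℂ) (β α : ℕ → ℝ), g 0 = G ∧ (∀ k, |β k| ≤ R) ∧ (∀ k, |α k| ≤ R) ∧
      ∀ z : ℂ, R < ‖z‖ → ∀ k, ‖g k z‖ ≤ 1 / (‖z‖ - R) ∧
        g k z * (z - β k - (α k : ℂ) ^ 2 * g (k + 1) z) = 1 := by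
  let S := {p : (H →L[ℂ] H) × H × (ℂ → ℂ) // IsResolventFunction R p.1 p.2.1 p.2.2}
  have hstep : ∀ p : S, ∃ q : S, ∃ β α : ℝ, |β| ≤ R ∧ |α| ≤ R ∧
      ∀ z : ℂ, R < ‖z‖ → p.1.2.2 z * (z - β - (α : ℂ) ^ 2 * q.1.2.2 z) = 1 := by
    rintro ⟨⟨A, e, G⟩, hp⟩
    obtain ⟨A', e', G', β, α, h1, h2, h3, h4⟩ := hp.exists_step
    exact ⟨⟨(A', e', G'), h1⟩, β, α, h2, h3, h4⟩
  choose next β α hβ hα hrec using hstep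
  let s : ℕ → S := fun k => next^[k] ⟨(A, e, G), h⟩
  have hs : ∀ k, s (k + 1) = next (s k) := fun k => Function.iterate_succ_apply' _ _ _
  refine ⟨fun k => (s k).1.2.2, fun k => β (s k), fun k => α (s k), rfl, fun k => hβ _,
    fun k => hα _, fun z hz k => ⟨(s k).2.norm_apply_le hz, ?_⟩⟩
  simp only [hs]
  exact hrec (s k) z hz

end Schur

/-! ### The continued fraction of a Stieltjes transform. -/

section Stieltjes

/-- The Stieltjes transform of a compactly supported probability measure has a continued fraction
expansion with bounded coefficients. -/
theorem exists_continuedFraction_stieltjes (ν : Measure ℝ) [IsProbabilityMeasure ν]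
    (hν : IsCompact ν.support) :
    ∃ (R : ℝ) (g : ℕ → ℂ → ℂ) (β α : ℕ → ℝ), 0 ≤ R ∧ IsStieltjesOutside ν R (g 0) ∧
      (∀ k, |β k| ≤ R) ∧ (∀ k, |α k| ≤ R) ∧
      ∀ z : ℂ, R < ‖z‖ → ∀ k, ‖g k z‖ ≤ 1 / (‖z‖ - R) ∧
        g k z * (z - β k - (α k : ℂ) ^ 2 * g (k + 1) z) = 1 := by
  have hem : MeasurableEmbedding (fun x : ℝ => (x : ℂ)) :=
    Complex.isometry_ofReal.isClosedEmbedding.measurableEmbedding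
  set μ : Measure ℂ := ν.map (fun x : ℝ => (x : ℂ)) with hμdef
  have hprob : IsProbabilityMeasure μ :=
    Measure.isProbabilityMeasure_map hem.measurable.aemeasurable
  have hsub : μ.support ⊆ (fun x : ℝ => (x : ℂ)) '' ν.support := by
    refine Measure.support_subset_of_isClosed
      ((hν.image Complex.continuous_ofReal).isClosed) ?_
    rw [mem_ae_iff, hμdef, hem.map_apply]
    convert Measure.measure_compl_support (μ := ν) using 2
    ext x
    simp
  have hμ : IsCompact μ.support :=
    (hν.image Complex.continuous_ofReal).of_isClosed_subset Measure.isClosed_support hsub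
  obtain ⟨r, hr⟩ := hν.isBounded.exists_norm_le
  set R := max ‖mulZ μ hμ‖ r with hR
  have hne : ∀ z : ℂ, R < ‖z‖ → ∀ x ∈ ν.support, ‖z‖ - R ≤ ‖z - (x : ℂ)‖ := by
    intro z hz x hx
    have h1 := norm_sub_norm_le z (x : ℂ)
    have h2 := hr x hx
    rw [Complex.norm_real] at h1
    linarith [le_max_right ‖mulZ μ hμ‖ r]
  have hmeas : ∀ z : ℂ, Measurable (fun w : ℂ => 1 / (z - w)) := fun z => by fun_prop
  have hbound : ∀ z : ℂ, R < ‖z‖ → ∀ᵐ w ∂μ, ‖1 / (z - w)‖ ≤ 1 / (‖z‖ - R) := by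
    intro z hz
    filter_upwards [Measure.support_mem_ae (μ := μ)] with w hw
    obtain ⟨x, hx, rfl⟩ := hsub hw
    rw [norm_div, norm_one]
    exact one_div_le_one_div_of_le (by linarith) (hne z hz x hx)
  have hLp : ∀ z : ℂ, R < ‖z‖ → ∀ p : ℝ≥0∞, MemLp (fun w : ℂ => 1 / (z - w)) p μ := fun z hz p =>
    (memLp_top_of_bound (hmeas z).aestronglyMeasurable _ (hbound z hz)).mono_exponent le_top
  have hone : ‖polyLp hμ 1‖ = 1 :=
    norm_eq_one_of_inner_self (by rw [inner_polyLp, polyInner]; simp)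
  have hsymm := inner_mulZ_left hμ (hsub.trans (Set.image_subset_range _ _))
  obtain ⟨G, hG⟩ := exists_isResolventFunction hsymm (le_max_left _ r) hone
  obtain ⟨g, β, α, h0, hβ, hα, hg⟩ := hG.exists_continuedFraction
  refine ⟨R, g, β, α, (norm_nonneg _).trans (le_max_left _ r), fun z hz => ⟨?_, ?_⟩, hβ, hα, hg⟩
  · exact hem.integrable_map_iff.1 ((hLp z hz 1).integrable le_rfl)
  -- The resolvent of `ℳ` applied to `1` is `w ↦ 1 / (z - w)`.
  · have h1 : z • (hLp z hz 2).toLp _ - mulZ μ hμ ((hLp z hz 2).toLp _) = polyLp hμ 1 := by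
      refine Lp.ext ?_
      filter_upwards [Lp.coeFn_sub (z • (hLp z hz 2).toLp _) (mulZ μ hμ ((hLp z hz 2).toLp _)),
        Lp.coeFn_smul z ((hLp z hz 2).toLp _), coeFn_mulZ hμ ((hLp z hz 2).toLp _),
        (hLp z hz 2).coeFn_toLp, coeFn_polyLp hμ 1, Measure.support_mem_ae (μ := μ)]
        with w h1 h2 h3 h4 h5 hw
      obtain ⟨x, hx, rfl⟩ := hsub hw
      have h6 : z - (x : ℂ) ≠ 0 := by
        rw [← norm_pos_iff]
        linarith [hne z hz x hx]
      rw [h1, Pi.sub_apply, h2, Pi.smul_apply, h3, h4, h5, eval_one, smul_eq_mul, ← sub_mul]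
      exact mul_one_div_cancel h6
    rw [h0, hG.eq_inner z hz _ h1, L2.inner_def]
    have h2 : ∫ w : ℝ, 1 / (z - (w : ℂ)) ∂ν = ∫ w, 1 / (z - w) ∂μ := by
      rw [hμdef, hem.integral_map]
    rw [h2]
    refine integral_congr_ae ?_
    filter_upwards [(hLp z hz 2).coeFn_toLp, coeFn_polyLp hμ 1] with w h3 h4
    rw [h3, h4]
    simp [RCLike.inner_apply]

end Stieltjes

/-! ### Reversed blocks of coefficients and the contraction estimate. -/

section Blocks

/-- The natural numbers are cut into consecutive blocks of lengths `1, 2, 3, …`; the `n`-th number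
lies in the block `(blockIndex n).1` and is followed by `(blockIndex n).2` further members of its
block. -/
def blockIndex : ℕ → ℕ × ℕ
  | 0 => (0, 0)
  | n + 1 =>
    if (blockIndex n).2 = 0 then ((blockIndex n).1 + 1, (blockIndex n).1 + 1)
    else ((blockIndex n).1, (blockIndex n).2 - 1)

theorem blockIndex_succ_of_eq_zero {n : ℕ} (h : (blockIndex n).2 = 0) :
    blockIndex (n + 1) = ((blockIndex n).1 + 1, (blockIndex n).1 + 1) := by
  rw [blockIndex, if_pos h]

theorem blockIndex_succ_of_ne_zero {n : ℕ} (h : (blockIndex n).2 ≠ 0) :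
    blockIndex (n + 1) = ((blockIndex n).1, (blockIndex n).2 - 1) := by
  rw [blockIndex, if_neg h]

theorem blockIndex_snd_le_fst (n : ℕ) : (blockIndex n).2 ≤ (blockIndex n).1 := by
  induction n with
  | zero => simp [blockIndex]
  | succ n ih =>
    by_cases h : (blockIndex n).2 = 0
    · rw [blockIndex_succ_of_eq_zero h]
    · rw [blockIndex_succ_of_ne_zero h]; dsimp only; omega

theorem exists_blockIndex_snd_eq_zero (n : ℕ) :
    ∃ m, n ≤ m ∧ (blockIndex m).2 = 0 ∧ (blockIndex m).1 = (blockIndex n).1 := by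
  obtain ⟨k, hk⟩ : ∃ k, (blockIndex n).2 = k := ⟨_, rfl⟩
  induction k generalizing n with
  | zero => exact ⟨n, le_rfl, hk, rfl⟩
  | succ k ih =>
    have h := blockIndex_succ_of_ne_zero (n := n) (by omega)
    obtain ⟨m, h1, h2, h3⟩ := ih (n + 1) (by rw [h, hk]; rfl)
    exact ⟨m, by omega, h2, by rw [h3, h]⟩

theorem tendsto_blockIndex_fst : Tendsto (fun n => (blockIndex n).1) atTop atTop := by
  refine tendsto_atTop_atTop_of_monotone (monotone_nat_of_le_succ fun n => ?_) fun m => ?_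
  · by_cases h : (blockIndex n).2 = 0
    · rw [blockIndex_succ_of_eq_zero h]; exact Nat.le_succ _
    · rw [blockIndex_succ_of_ne_zero h]
  · induction m with
    | zero => exact ⟨0, Nat.zero_le _⟩
    | succ m ih =>
      obtain ⟨n, hn⟩ := ih
      obtain ⟨l, -, h2, h3⟩ := exists_blockIndex_snd_eq_zero n
      exact ⟨l + 1, by rw [blockIndex_succ_of_eq_zero h2]; dsimp only; omega⟩

/-- The numbers following the end of a block. -/
def blockEnds : Set ℕ := {n | 1 ≤ n ∧ (blockIndex (n - 1)).2 = 0}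

theorem infinite_blockEnds : blockEnds.Infinite := by
  refine Set.infinite_of_forall_exists_gt fun n => ?_
  obtain ⟨m, h1, h2, -⟩ := exists_blockIndex_snd_eq_zero n
  exact ⟨m + 1, ⟨by omega, by simpa using h2⟩, by omega⟩

/-- Squares of the off-diagonal recurrence coefficients: reversed copies of initial segments of
`α`, weakly coupled with one another. -/
def blockWeight (α : ℕ → ℝ) (n : ℕ) : ℝ :=
  1 / ((blockIndex n).1 + 1) +
    -- Equality marks the first index of a block, where only the weak coupling to the previous block
    -- remains.
    if (blockIndex n).2 = (blockIndex n).1 then 0 else α (blockIndex n).2 ^ 2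

theorem blockWeight_pos (α : ℕ → ℝ) (n : ℕ) : 0 < blockWeight α n := by
  rw [blockWeight]
  have : (0 : ℝ) < 1 / ((blockIndex n).1 + 1) := by positivity
  split_ifs <;> positivity

theorem blockWeight_le {α : ℕ → ℝ} {R : ℝ} (hα : ∀ k, |α k| ≤ R) (n : ℕ) :
    blockWeight α n ≤ 1 + R ^ 2 := by
  rw [blockWeight]
  refine add_le_add ?_ ?_
  · rw [div_le_one (by positivity)]
    have : (0 : ℝ) ≤ (blockIndex n).1 := Nat.cast_nonneg _
    linarith
  · split_ifs
    · positivity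
    · exact sq_le_sq' (by linarith [(abs_le.1 (hα (blockIndex n).2)).1]) (abs_le.1 (hα _)).2

theorem norm_le_one_div {x y : ℂ} {D : ℝ} (hD : 0 < D) (h : x * y = 1) (hy : D ≤ ‖y‖) :
    ‖x‖ ≤ 1 / D := by
  have h1 : ‖x‖ * ‖y‖ = 1 := by rw [← norm_mul, h, norm_one]
  rw [le_div_iff₀ hD]
  nlinarith [norm_nonneg x]

/-- Within a block the ratios approach the tails of the continued fraction. -/
theorem norm_sub_le_of_block {r g : ℕ → ℂ} {α β : ℕ → ℝ} {R C : ℝ} {z : ℂ}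
    (hz : R + 3 + 3 * R ^ 2 ≤ ‖z‖) (hα : ∀ k, |α k| ≤ R) (hβ : ∀ k, |β k| ≤ R)
    (hg : ∀ k, ‖g k‖ ≤ 1) (hgrec : ∀ k, g k * (z - β k - (α k : ℂ) ^ 2 * g (k + 1)) = 1)
    (hr : ∀ n, 1 ≤ n → ‖r n‖ ≤ C)
    (hrec : ∀ n, 1 ≤ n → r (n + 1) * (z - β (blockIndex n).2 - (blockWeight α n : ℂ) * r n) = 1)
    {n : ℕ} (hn : 1 ≤ n) (hC : C ≤ (blockIndex n).1 + 1) :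
    ‖r (n + 1)‖ ≤ 1 ∧ ‖r (n + 1) - g (blockIndex n).2‖ ≤
      2 * (1 / 2) ^ ((blockIndex n).1 - (blockIndex n).2) + 1 / ((blockIndex n).1 + 1) := by
  have hden : ∀ (k : ℕ) (x : ℂ), ‖z‖ - R - ‖x‖ ≤ ‖z - β k - x‖ := fun k x => by
    have h1 := norm_sub_norm_le (z - β k) x
    have h2 := norm_sub_norm_le z (β k : ℂ)
    rw [Complex.norm_real, Real.norm_eq_abs] at h2
    linarith [hβ k]
  have hw : ∀ n, ‖(blockWeight α n : ℂ)‖ = blockWeight α n := fun n => by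
    rw [Complex.norm_real, Real.norm_eq_abs, abs_of_pos (blockWeight_pos α n)]
  have hεpos : ∀ m : ℕ, (0 : ℝ) < 1 / (m + 1) := fun m => by positivity
  induction n with
  | zero => omega
  | succ n ih =>
    have hrec' := hrec (n + 1) hn
    by_cases h0 : (blockIndex n).2 = 0
    · have hs := blockIndex_succ_of_eq_zero h0
      have hwe : blockWeight α (n + 1) = 1 / ((blockIndex (n + 1)).1 + 1) := by
        rw [blockWeight, if_pos (by rw [hs]), add_zero]
      have h1 : ‖(blockWeight α (n + 1) : ℂ) * r (n + 1)‖ ≤ 1 := by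
        rw [norm_mul, hw, hwe, one_div, inv_mul_le_iff₀ (by positivity), mul_one]
        exact (hr _ hn).trans hC
      have h2 := hden (blockIndex (n + 1)).2 ((blockWeight α (n + 1) : ℂ) * r (n + 1))
      have h3 : ‖r (n + 1 + 1)‖ ≤ 1 := by
        simpa using norm_le_one_div one_pos hrec' (by nlinarith [sq_nonneg R])
      refine ⟨h3, ?_⟩
      have h4 : (blockIndex (n + 1)).1 - (blockIndex (n + 1)).2 = 0 := by rw [hs]; simp
      rw [h4, pow_zero, mul_one]
      refine (norm_sub_le _ _).trans ?_
      linarith [hg (blockIndex (n + 1)).2, hεpos (blockIndex (n + 1)).1]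
    · have hs := blockIndex_succ_of_ne_zero h0
      have hn1 : 1 ≤ n := by
        rcases Nat.eq_zero_or_pos n with rfl | h
        · exact absurd rfl h0
        · exact h
      have hle := blockIndex_snd_le_fst n
      obtain ⟨m, k, hmk⟩ : ∃ m k, blockIndex n = (m, k + 1) :=
        ⟨(blockIndex n).1, (blockIndex n).2 - 1, Prod.ext rfl (by dsimp only; omega)⟩
      rw [hmk] at hs hle ih
      simp only [Nat.add_sub_cancel] at hs
      dsimp only at hle ih
      have hwe : blockWeight α (n + 1) = 1 / (m + 1) + α k ^ 2 := by
        rw [blockWeight, hs, if_neg (by dsimp only; omega)]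
      rw [hs] at hrec' hC ⊢
      dsimp only at hrec' hC ⊢
      obtain ⟨ih1, ih2⟩ := ih hn1 hC
      have hwle := blockWeight_le hα (n + 1)
      have h1 : ‖(blockWeight α (n + 1) : ℂ) * r (n + 1)‖ ≤ 1 + R ^ 2 := by
        rw [norm_mul, hw]
        nlinarith [blockWeight_pos α (n + 1)]
      have h2 := hden k ((blockWeight α (n + 1) : ℂ) * r (n + 1))
      -- The denominator is at least `(3 + 3R²) - (1 + R²)`; this is where the threshold on `‖z‖`
      -- comes from.
      have h3 : ‖r (n + 1 + 1)‖ ≤ 1 / (2 * (1 + R ^ 2)) :=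
        norm_le_one_div (by positivity) hrec' (by linarith)
      have hαk : α k ^ 2 ≤ 1 + R ^ 2 := by
        have := sq_le_sq' (by linarith [(abs_le.1 (hα k)).1]) (abs_le.1 (hα k)).2
        linarith
      refine ⟨h3.trans ?_, ?_⟩
      · rw [div_le_one (by positivity)]; nlinarith [sq_nonneg R]
      -- Difference of two reciprocals. With `ε = 1/(m+1)` the error obeys `δ_k ≤ (ε + δ_{k+1}) /
      -- 2`, which the bound `2 · 2^{-(m-k)} + ε` reproduces.
      · have h4 : r (n + 1 + 1) - g k = r (n + 1 + 1) * g k *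
            (((1 / (m + 1) : ℝ) : ℂ) * r (n + 1) + (α k : ℂ) ^ 2 * (r (n + 1) - g (k + 1))) := by
          have hwc : (blockWeight α (n + 1) : ℂ) = ((1 / (m + 1) : ℝ) : ℂ) + (α k : ℂ) ^ 2 := by
            rw [hwe, Complex.ofReal_add, Complex.ofReal_pow]
          rw [hwc] at hrec'
          linear_combination (g k) * hrec' - r (n + 1 + 1) * hgrec k
        have h5 : ‖((1 / (m + 1) : ℝ) : ℂ) * r (n + 1) +
            (α k : ℂ) ^ 2 * (r (n + 1) - g (k + 1))‖ ≤
            (1 + R ^ 2) * (1 / (m + 1) + ‖r (n + 1) - g (k + 1)‖) := by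
          refine (norm_add_le _ _).trans ?_
          rw [norm_mul, norm_mul, Complex.norm_real, norm_pow, Complex.norm_real,
            Real.norm_of_nonneg (hεpos m).le, Real.norm_eq_abs, sq_abs, mul_add]
          have hε := hεpos m
          refine add_le_add ?_ (by gcongr)
          nlinarith [sq_nonneg R, mul_nonneg hε.le (sq_nonneg R)]
        have h6 : ‖r (n + 1 + 1) - g k‖ ≤ 1 / (2 * (1 + R ^ 2)) * 1 *
            ((1 + R ^ 2) * (1 / (m + 1) + ‖r (n + 1) - g (k + 1)‖)) := by
          rw [h4, norm_mul, norm_mul]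
          gcongr
          exact hg k
        have h7 : 1 / (2 * (1 + R ^ 2)) * 1 *
            ((1 + R ^ 2) * (1 / ((m : ℝ) + 1) + ‖r (n + 1) - g (k + 1)‖)) =
            (1 / ((m : ℝ) + 1) + ‖r (n + 1) - g (k + 1)‖) / 2 := by
          have : (1 + R ^ 2) ≠ 0 := by positivity
          field_simp
        have h8 : m - k = m - (k + 1) + 1 := by omega
        rw [h8, pow_succ]
        rw [h7] at h6
        linarith

end Blocks

/-- Every Stieltjes transform is a subsequential limit of ratios of orthogonal polynomials. -/
theorem exists_isRatioLimitAlong (ν : Measure ℝ) [IsProbabilityMeasure ν]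
    (hν : IsCompact ν.support) :
    ∃ (μ : Measure ℂ) (hμ : IsCompact μ.support), IsProbabilityMeasure μ ∧
      μ.support.Infinite ∧ μ.support ⊆ Set.range (fun x : ℝ => (x : ℂ)) ∧
      ∃ (N : Set ℕ) (f : ℂ → ℂ), IsStieltjesOutside ν ‖mulZ μ hμ‖ f ∧
        IsRatioLimitAlong μ hμ N f := by
  obtain ⟨R, g, β, α, hR, hg0, hβ, hα, hg⟩ := exists_continuedFraction_stieltjes ν hν
  set K : ℝ := R + 3 + 3 * R ^ 2 with hK
  have hRK : R + 1 ≤ K := by nlinarith [sq_nonneg R]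
  -- `b 0 = K` is the mean of `μ`, so `‖ℳ‖ ≥ K` and every admissible `z` meets the threshold of
  -- `norm_sub_le_of_block`.
  set b : ℕ → ℝ := fun n => if n = 0 then K else β (blockIndex n).2 with hb
  set a : ℕ → ℝ := fun n => √(blockWeight α n) with ha
  have ha2 : ∀ n, a n ^ 2 = blockWeight α n := fun n => Real.sq_sqrt (blockWeight_pos α n).le
  have hbK : ∀ n, |b n| ≤ K := by
    intro n
    simp only [hb]
    split_ifs
    · rw [abs_of_nonneg (by linarith)]
    · linarith [hβ (blockIndex n).2]
  have haA : ∀ n, |a n| ≤ √(1 + R ^ 2) := by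
    intro n
    rw [abs_of_nonneg (Real.sqrt_nonneg _)]
    exact Real.sqrt_le_sqrt (blockWeight_le hα n)
  obtain ⟨μ, hprob, hμ, hinf, hr, hP⟩ := exists_measure_of_recurrence hbK haA
    (fun n => (Real.sqrt_pos.2 (blockWeight_pos α n)).ne')
  have hKM : K ≤ ‖mulZ μ hμ‖ := (le_abs_self K).trans
    (abs_le_norm_mulZ hμ hinf (by rw [hP, recurrencePoly]; simp [hb]))
  refine ⟨μ, hμ, hprob, hinf, hr, blockEnds, g 0, fun z hz => hg0 z (by linarith),
    fun n hn => hn.1, infinite_blockEnds, fun z hz => ?_⟩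
  have hzR : R < ‖z‖ := by linarith
  set r : ℕ → ℂ := fun n => (monicOP μ (n - 1)).eval z / (monicOP μ n).eval z with hrdef
  have hne := eval_monicOP_ne_zero hμ hinf hz
  set C := 1 / (‖z‖ - ‖mulZ μ hμ‖) with hC
  have hrC : ∀ n, 1 ≤ n → ‖r n‖ ≤ C := by
    intro n hn
    obtain ⟨n, rfl⟩ := Nat.exists_eq_add_of_le' hn
    exact norm_ratio_le hμ hinf hr hz n
  have hrec : ∀ n, 1 ≤ n →
      r (n + 1) * (z - β (blockIndex n).2 - (blockWeight α n : ℂ) * r n) = 1 := by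
    intro n hn
    obtain ⟨n, rfl⟩ := Nat.exists_eq_add_of_le' hn
    have h1 : (monicOP μ (n + 2)).eval z = (z - β (blockIndex (n + 1)).2) *
        (monicOP μ (n + 1)).eval z - (blockWeight α (n + 1) : ℂ) * (monicOP μ n).eval z := by
      rw [hP, hP, hP, recurrencePoly, ← ha2]
      simp [hb]
    have h2 := hne (n + 1)
    have h3 := hne (n + 2)
    simp only [hrdef, Nat.add_sub_cancel]
    rw [show n + 1 + 1 = n + 2 from rfl, div_mul_eq_mul_div, div_eq_one_iff_eq h3, h1]
    field_simp
  have hg1 : ∀ k, ‖g k z‖ ≤ 1 := fun k => (hg z hzR k).1.trans <| by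
    rw [div_le_one (by linarith)]; linarith
  have hm := tendsto_blockIndex_fst.comp (tendsto_sub_atTop_nat 1)
  have hlim : Tendsto (fun n : ℕ => 2 * (1 / 2 : ℝ) ^ (blockIndex (n - 1)).1 +
      1 / (((blockIndex (n - 1)).1 : ℝ) + 1)) atTop (𝓝 0) := by
    have h1 := ((tendsto_pow_atTop_nhds_zero_of_lt_one (r := (1 / 2 : ℝ)) (by norm_num)
      (by norm_num)).const_mul 2).add tendsto_one_div_add_atTop_nhds_zero_nat
    rw [mul_zero, add_zero] at h1
    exact h1.comp hm
  rw [tendsto_iff_norm_sub_tendsto_zero]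
  refine squeeze_zero' (Eventually.of_forall fun _ => norm_nonneg _) ?_
    (hlim.mono_left inf_le_left)
  have hev : ∀ᶠ n : ℕ in atTop, C ≤ (blockIndex (n - 1)).1 + 1 := by
    filter_upwards [(tendsto_natCast_atTop_atTop (R := ℝ)).comp hm |>.eventually_ge_atTop C]
      with n hn
    simp only [Function.comp_apply] at hn
    linarith
  rw [eventually_inf_principal]
  filter_upwards [hev, eventually_ge_atTop 2] with n h1 h2 h3
  -- At a block end the remaining length is `0`, so the target is `g 0` and the exponent is the full
  -- block index.
  have h4 := (norm_sub_le_of_block (g := fun k => g k z) (by linarith) hα hβ hg1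
    (fun k => (hg z hzR k).2) hrC hrec (n := n - 1) (by omega) h1).2
  rw [h3.2, Nat.sub_zero, Nat.sub_add_cancel (by omega)] at h4
  exact h4

end RatioAsymptotics

end

theorem theorem3p1 :
    -- every subsequential limit is a Stieltjes transform
    (∀ (μ : Measure ℂ) [IsFiniteMeasure μ] (hμ : IsCompact μ.support),
      μ.support.Infinite → μ.support ⊆ Set.range (fun x : ℝ => (x : ℂ)) →
      ∀ (N : Set ℕ) (f : ℂ → ℂ), RatioAsymptotics.IsRatioLimitAlong μ hμ N f →
        ∃ ν : Measure ℝ, IsProbabilityMeasure ν ∧ IsCompact ν.support ∧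
          RatioAsymptotics.IsStieltjesOutside ν ‖RatioAsymptotics.mulZ μ hμ‖ f) ∧
    -- every Stieltjes transform is a subsequential limit
    (∀ (ν : Measure ℝ) [IsProbabilityMeasure ν], IsCompact ν.support →
      ∃ (μ : Measure ℂ) (hμ : IsCompact μ.support), IsProbabilityMeasure μ ∧
        μ.support.Infinite ∧ μ.support ⊆ Set.range (fun x : ℝ => (x : ℂ)) ∧
        ∃ (N : Set ℕ) (f : ℂ → ℂ),
          RatioAsymptotics.IsStieltjesOutside ν ‖RatioAsymptotics.mulZ μ hμ‖ f ∧
          RatioAsymptotics.IsRatioLimitAlong μ hμ N f) :=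
  ⟨fun _ _ hμ hinf hr _ _ hf =>
    RatioAsymptotics.exists_isStieltjesOutside_of_isRatioLimitAlong hμ hinf hr hf,
    fun ν _ hν => RatioAsymptotics.exists_isRatioLimitAlong ν hν⟩
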